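/- Consider a route through $L\ge 2$ reconfigurable intelligent surfaces, where the $i$-th surface has $N_i\ge 1$ elements. Let $P_t>0$ be the transmit power, $\sigma^2>0$ the noise power, $G=G_tG_r>0$ the product of the antenna gains, and $l_c=\prod_{i=1}^{L+1}C_0\,(d_i/d_0)^{-n_i}$ the total path loss, where $C_0,d_0,d_i>0$ and $n_i\in\mathbb R$. For $k\in\{1,L\}$ let $m_k,\Omega_k>0$ be the shape and spread parameters of the Nakagami fading and $\kappa_k>0$ the concentration parameter of the phase error, let $t_{n,k}=\mathbb E[e^{jn\phi_k}]$, where $\phi_k$ has the zero-mean von Mises distribution with concentration $\kappa_k$ (density proportional to $e^{\kappa_k\cos\phi}$ on $(-\pi,\pi]$), and put $$\bar\Omega_k=t_{1,k}^2\left(\frac{\Gamma(m_k+\tfrac12)}{\Gamma(m_k)}\sqrt{\frac{\Omega_k}{m_k}}\right)^2,\qquad \bar m_k=\frac{N_k\bar\Omega_k}{2+2t_{2,k}-4\bar\Omega_k},$$ where it is assumed that $2+2t_{2,k}-4\bar\Omega_k>0$, so that $(\bar m_k,\bar\Omega_k)$ are admissible Nakagami parameters. Let $Z_1$ and $Z_L$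 be independent random variables, where $Z_k$ has the Nakagami-$m$ distribution with shape $\bar m_k$ and spread $\bar\Omega_k$, i.e. the density $$\frac{2\,\bar m_k^{\bar m_k}}{\Gamma(\bar m_k)\,\bar\Omega_k^{\bar m_k}}\,x^{2\bar m_k-1}e^{-\bar m_kx^2/\bar\Omega_k},\qquad x>0,$$ and let the received signal-to-noise ratio be $$\gamma_r=\frac{P_t}{\sigma^2}\,l_c\,G\left(\Big(\prod_{i=1}^LN_i\Big)Z_1Z_L\right)^2.$$ Then for every $x>0$ the distribution function of $Z_1Z_L$ is $$\Pr(Z_1Z_L\le x)=\frac{1}{\Gamma(\bar m_1)\Gamma(\bar m_L)}\;G^{2,1}_{1,3}\!\left(x^2\,\frac{\bar m_1\bar m_L}{\bar\Omega_1\bar\Omega_L}\;\middle|\;\begin{matrix}1\\ \bar m_1,\bar m_L,0\end{matrix}\right).$$ Here $G^{2,1}_{1,3}$ is the Meijer G-function, defined by its Mellin–Barnes integral along a vertical line that separates the two families of poles of the integrand; such lines exist, the integral converges absolutely along each of them, and its value does not depend on the line. Consequently, for every threshold $\gamma_{\mathrm{thr}}>0$ the outage probability is $$\Pr(\gamma_r\le\gamma_{\mathrm{thr}})=\Pr(Z_1Z_L\le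 w)=\frac{1}{\Gamma(\bar m_1)\Gamma(\bar m_L)}\;G^{2,1}_{1,3}\!\left(w^2\,\frac{\bar m_1\bar m_L}{\bar\Omega_1\bar\Omega_L}\;\middle|\;\begin{matrix}1\\ \bar m_1,\bar m_L,0\end{matrix}\right),\qquad w=\sqrt{\frac{\gamma_{\mathrm{thr}}\,\sigma^2}{P_t\,l_c\,G\prod_{i=1}^LN_i^2}}.$$ -/

import Mathlib

open MeasureTheory ProbabilityTheory

noncomputable section

/-! ### The Meijer G-function -/

/-- The integrand of the Mellin-Barnes integral of the Meijer function `G^{m,n}_{p,q}(z | a; b)`: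
`∏_{j ≤ m} Γ(b_j - s) ∏_{j ≤ n} Γ(1 - a_j + s) z^s` divided by
`∏_{j > m} Γ(1 - b_j + s) ∏_{j > n} Γ(a_j - s)`.
The reciprocals are written as inverses, which is consistent with the entire function `1/Γ`:
`Complex.Gamma` has the value `0` at the poles of `Γ`, and so has its inverse. -/
def meijerGIntegrand (m n : ℕ) {p q : ℕ} (a : Fin p → ℂ) (b : Fin q → ℂ) (z s : ℂ) : ℂ :=
  (∏ j : Fin q,
      if (j : ℕ) < m then Complex.Gamma (b j - s) else (Complex.Gamma (1 - b j + s))⁻¹) *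
    (∏ j : Fin p,
      if (j : ℕ) < n then Complex.Gamma (1 - a j + s) else (Complex.Gamma (a j - s))⁻¹) *
    z ^ s

/-- The vertical line `Re s = c` has all poles of `Γ(b_j - s)`, `j ≤ m`, on its right and
all poles of `Γ(1 - a_j + s)`, `j ≤ n`, on its left. -/
def MeijerGSeparating (m n : ℕ) {p q : ℕ} (a : Fin p → ℂ) (b : Fin q → ℂ) (c : ℝ) : Prop :=
  (∀ j : Fin q, (j : ℕ) < m → c < (b j).re) ∧ (∀ j : Fin p, (j : ℕ) < n → (a j).re - 1 < c)

/-- `(2πi)⁻¹ ∫ meijerGIntegrand(s) ds` along the line `Re s = c`, upwards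
(with `s = c + i t`, `ds = i dt`). -/
def meijerGLine (m n : ℕ) {p q : ℕ} (a : Fin p → ℂ) (b : Fin q → ℂ) (z : ℂ) (c : ℝ) : ℂ :=
  (2 * (Real.pi : ℂ))⁻¹ * ∫ t : ℝ, meijerGIntegrand m n a b z ((c : ℂ) + (t : ℂ) * Complex.I)

open Classical in
/-- The Meijer function `G^{m,n}_{p,q}(z | a; b)`, as the Mellin-Barnes integral along a vertical
line that separates the two families of poles, for parameters that admit such a line. -/
def meijerG (m n : ℕ) {p q : ℕ} (a : Fin p → ℂ) (b : Fin q → ℂ) (z : ℂ) : ℂ :=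
  if h : ∃ c : ℝ, MeijerGSeparating m n a b c then meijerGLine m n a b z h.choose else 0

/-- The defining integral of `G^{m,n}_{p,q}(z | a; b)` makes sense: there is a separating vertical
line, the integral converges absolutely along each of them, and its value does not depend on the
line. -/
def MeijerGWellDefined (m n : ℕ) {p q : ℕ} (a : Fin p → ℂ) (b : Fin q → ℂ) (z : ℂ) : Prop :=
  (∃ c : ℝ, MeijerGSeparating m n a b c) ∧
    ∀ c : ℝ, MeijerGSeparating m n a b c →
      Complex.VerticalIntegrable (meijerGIntegrand m n a b z) c ∧
        meijerGLine m n a b z c = meijerG m n a b z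

/-! ### The Nakagami and von Mises distributions -/

/-- The density of the Nakagami-`m` distribution with shape `m` and spread `Ω`. -/
def nakagamiPDFReal (m Ω x : ℝ) : ℝ :=
  if 0 < x then
    2 * m ^ m / (Real.Gamma m * Ω ^ m) * x ^ (2 * m - 1) * Real.exp (-(m / Ω) * x ^ 2)
  else 0

/-- The Nakagami-`m` distribution with shape `m > 0` and spread `Ω > 0`. -/
def nakagamiMeasure (m Ω : ℝ) : Measure ℝ :=
  volume.withDensity fun x => ENNReal.ofReal (nakagamiPDFReal m Ω x)

/-- The (centred) von Mises distribution on `(-π, π]` with concentration parameter `κ`: its density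
is proportional to `exp (κ cos φ)`. -/
def vonMisesMeasure (κ : ℝ) : Measure ℝ :=
  (volume.restrict (Set.Ioc (-Real.pi) Real.pi)).withDensity fun φ =>
    ENNReal.ofReal
      (Real.exp (κ * Real.cos φ) / ∫ θ in (-Real.pi)..Real.pi, Real.exp (κ * Real.cos θ))

/-- The `n`-th trigonometric moment `E[e^{i n φ}]` of the centred von Mises distribution.
It is a real number, because the distribution is symmetric; it is taken as a real number here. -/
def trigMoment (n : ℕ) (κ : ℝ) : ℝ :=
  (∫ φ, Complex.exp (Complex.I * (n : ℂ) * (φ : ℂ)) ∂(vonMisesMeasure κ)).re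

/-! ### The cascaded network -/

/-- The parameters of a route through `L` reconfigurable intelligent surfaces. The surfaces are
numbered `1, …, L` and the links of the route `1, …, L + 1`; the values of the functions at other
indices play no role. The fading parameters `m`, `Ω` and `κ` matter at the first and the last
surface only. -/
structure CascadedRIS where
  /-- number of surfaces -/
  L : ℕ
  two_le_L : 2 ≤ L
  /-- number of reflecting elements of each surface -/
  N : ℕ → ℕ
  N_pos : ∀ i ∈ Finset.Icc 1 L, 0 < N i
  /-- shape parameters of the channel coefficients -/
  m : ℕ → ℝ
  m_pos : ∀ k, k = 1 ∨ k = L → 0 < m k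
  /-- spread parameters of the channel coefficients -/
  Ω : ℕ → ℝ
  Ω_pos : ∀ k, k = 1 ∨ k = L → 0 < Ω k
  /-- concentration parameters of the phase errors -/
  κ : ℕ → ℝ
  κ_pos : ∀ k, k = 1 ∨ k = L → 0 < κ k
  /-- path loss at the reference distance -/
  C₀ : ℝ
  C₀_pos : 0 < C₀
  /-- reference distance -/
  d₀ : ℝ
  d₀_pos : 0 < d₀
  /-- lengths of the links -/
  d : ℕ → ℝ
  d_pos : ∀ i ∈ Finset.Icc 1 (L + 1), 0 < d i
  /-- path loss exponents of the links -/
  n : ℕ → ℝ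
  /-- antenna gain of the transmitter -/
  Gt : ℝ
  Gt_pos : 0 < Gt
  /-- antenna gain of the receiver -/
  Gr : ℝ
  Gr_pos : 0 < Gr
  /-- transmit power -/
  Pt : ℝ
  Pt_pos : 0 < Pt
  /-- standard deviation of the noise; the noise power is `σ ^ 2` -/
  σ : ℝ
  σ_pos : 0 < σ

namespace CascadedRIS

/-- The total path loss `∏_{i=1}^{L+1} C₀ (d_i / d₀)^(-n_i)`. -/
def pathLoss (R : CascadedRIS) : ℝ :=
  ∏ i ∈ Finset.Icc 1 (R.L + 1), R.C₀ * (R.d i / R.d₀) ^ (-R.n i)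

/-- The product `G = G_t G_r` of the antenna gains. -/
def gain (R : CascadedRIS) : ℝ := R.Gt * R.Gr

/-- The spread parameter of the amplitude of the `k`-th sum, `k ∈ {1, L}`. -/
def spreadBar (R : CascadedRIS) (k : ℕ) : ℝ :=
  trigMoment 1 (R.κ k) ^ 2 *
    (Real.Gamma (R.m k + 1 / 2) / Real.Gamma (R.m k) * Real.sqrt (R.Ω k / R.m k)) ^ 2

/-- The denominator `2 + 2 t_2 - 4 Ω̄_k` of the shape parameter. -/
def shapeDenom (R : CascadedRIS) (k : ℕ) : ℝ :=
  2 + 2 * trigMoment 2 (R.κ k) - 4 * R.spreadBar k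

/-- The shape parameter of the amplitude of the `k`-th sum, `k ∈ {1, L}`. -/
def shapeBar (R : CascadedRIS) (k : ℕ) : ℝ :=
  (R.N k : ℝ) * R.spreadBar k / R.shapeDenom k

/-- The instantaneous received signal-to-noise ratio, when the amplitudes are `z₁` and `zL`. -/
def snr (R : CascadedRIS) (z₁ zL : ℝ) : ℝ :=
  R.Pt / R.σ ^ 2 * R.pathLoss * R.gain * ((∏ i ∈ Finset.Icc 1 R.L, (R.N i : ℝ)) * z₁ * zL) ^ 2

/-- The threshold `w` for the product of the amplitudes. -/
def w (R : CascadedRIS) (γthr : ℝ) : ℝ :=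
  Real.sqrt (γthr * R.σ ^ 2 /
    (R.Pt * R.pathLoss * R.gain * ∏ i ∈ Finset.Icc 1 R.L, (R.N i : ℝ) ^ 2))

/-- The argument `x² m̄_1 m̄_L / (Ω̄_1 Ω̄_L)` of the G-function. -/
def gArg (R : CascadedRIS) (x : ℝ) : ℝ :=
  x ^ 2 * (R.shapeBar 1 * R.shapeBar R.L / (R.spreadBar 1 * R.spreadBar R.L))

end CascadedRIS

end

/-! Put `V = (m₁ / Ω₁ * Z₁ ^ 2) * (m₂ / Ω₂ * Z₂ ^ 2)`. Each factor is a unit-rate Gamma variable, so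
by independence `E[V ^ s] = Γ(m₁ + s) Γ(m₂ + s) / (Γ(m₁) Γ(m₂))` for `Re s > -min m₁ m₂`
(`integrable_and_integral_cpow_nakagamiMeasure`). By Fubini the distribution function of `V` has
Mellin transform `-E[V ^ s] / s` for `Re s < 0` (`hasMellin_measureReal_Iic`). It is integrable
along `Re s = -c` for `0 < c < min m₁ m₂`, and `V` has no atom at the positive points in question,
so Mellin inversion applies there (`measureReal_Iic_eq_meijerGLine`). After `s ↦ -s` the inversion
integral is the Mellin-Barnes integral, since `Γ(s) / Γ(1 + s) = 1 / s`. Inversion holds for every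
admissible `c` with the same left-hand side, so independence of the line needs no contour shift. The
outage formula follows because the SNR is increasing in `Z₁ ZL > 0`. The barred parameters are
positive because the first von Mises moment is (`trigMoment_one_pos`). -/

/-! ### Bounds for `Γ` and absolute convergence of the Mellin-Barnes integral -/

/-- The absolute value of `Γ` on the right half-plane is bounded by its value at the real part. -/
lemma Complex.norm_Gamma_le_Gamma_re {s : ℂ} (hs : 0 < s.re) :
    ‖Complex.Gamma s‖ ≤ Real.Gamma s.re := by
  rw [Complex.Gamma_eq_integral hs, Real.Gamma_eq_integral hs, Complex.GammaIntegral]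
  refine (norm_integral_le_integral_norm _).trans_eq ?_
  refine setIntegral_congr_fun measurableSet_Ioi fun x hx => ?_
  have hx' : (0 : ℝ) < x := hx
  simp only [norm_mul, Complex.norm_cpow_eq_rpow_re_of_pos hx', Complex.norm_real, Real.norm_eq_abs,
    Real.abs_exp, Complex.sub_re, Complex.one_re]

/-- The recurrence `s Γ(s) = Γ(s + 1)` gains a factor `1 / |s|`. Together with the `1 / s` of the
integrand this gives quadratic decay, so no Stirling estimate is needed. -/
lemma Complex.norm_Gamma_le_div_norm {s : ℂ} (hs : 0 < s.re) :
    ‖Complex.Gamma s‖ ≤ Real.Gamma (s.re + 1) / ‖s‖ := by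
  have h0 : s ≠ 0 := by rintro rfl; simp at hs
  rw [le_div_iff₀ (norm_pos_iff.2 h0), mul_comm, ← norm_mul, ← Complex.Gamma_add_one s h0]
  simpa using Complex.norm_Gamma_le_Gamma_re (s := s + 1) (by simp; linarith)

/-- On the line `Re s = c`, `1 / |(a - s) s|` is dominated by `1 / (1 + t ^ 2)`. -/
lemma inv_norm_mul_inv_norm_le {c d : ℝ} (hc : 0 < c) (hd : 0 < d) (t : ℝ) :
    ‖(d : ℂ) - t * Complex.I‖⁻¹ * ‖(c : ℂ) + t * Complex.I‖⁻¹ ≤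
      (min (min c d) 1 ^ 2)⁻¹ * (1 + t ^ 2)⁻¹ := by
  -- `e` bounds both real parts from below; the cap at `1` gives `e ^ 2 + t ^ 2 ≥ e ^ 2 * (1 + t ^
  -- 2)`.
  set e := min (min c d) 1 with he
  have he0 : 0 < e := by positivity
  have key : ∀ z : ℂ, e ≤ z.re → z.im ^ 2 = t ^ 2 → e * Real.sqrt (1 + t ^ 2) ≤ ‖z‖ := by
    intro z h1 h2
    rw [Complex.norm_eq_sqrt_sq_add_sq, h2, ← Real.sqrt_sq he0.le, ← Real.sqrt_mul (by positivity)]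
    have he1 : e ≤ 1 := min_le_right _ _
    refine Real.sqrt_le_sqrt ?_
    have : e ^ 2 ≤ z.re ^ 2 := by gcongr
    nlinarith [mul_le_mul_of_nonneg_right (pow_le_one₀ (n := 2) he0.le he1) (sq_nonneg t)]
  have h1 := key ((d : ℂ) - t * Complex.I) (by simp [he]) (by simp)
  have h2 := key ((c : ℂ) + t * Complex.I) (by simp [he]) (by simp)
  rw [← mul_inv, ← mul_inv]
  refine inv_anti₀ (by positivity) ?_
  calc e ^ 2 * (1 + t ^ 2) = (e * Real.sqrt (1 + t ^ 2)) * (e * Real.sqrt (1 + t ^ 2)) := by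
        rw [mul_mul_mul_comm, Real.mul_self_sqrt (by positivity), sq]
    _ ≤ _ := by gcongr

lemma Complex.continuousAt_Gamma_of_re_pos {s : ℂ} (hs : 0 < s.re) :
    ContinuousAt Complex.Gamma s := by
  refine (Complex.differentiableAt_Gamma s fun m h => ?_).continuousAt
  have : s.re = -(m : ℝ) := by simp [h]
  have := m.cast_nonneg (α := ℝ)
  linarith

/-- `Γ(a - s) Γ(b - s) / s` is absolutely integrable along `Re s = c`, for `0 < c < min a b`. -/
lemma verticalIntegrable_Gamma_mul_Gamma_div {a b c : ℝ} (hc : 0 < c) (ha : c < a) (hb : c < b) :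
    Complex.VerticalIntegrable
      (fun s => Complex.Gamma (a - s) * Complex.Gamma (b - s) / s) c := by
  have hcont : Continuous fun t : ℝ => Complex.Gamma (a - ((c : ℂ) + t * Complex.I)) *
      Complex.Gamma (b - ((c : ℂ) + t * Complex.I)) / ((c : ℂ) + t * Complex.I) := by
    have hG : ∀ d : ℝ, c < d →
        Continuous fun t : ℝ => Complex.Gamma (d - ((c : ℂ) + t * Complex.I)) := by
      intro d hd
      refine continuous_iff_continuousAt.2 fun t => ?_
      refine ContinuousAt.comp (g := Complex.Gamma)
        (f := fun t : ℝ => (d : ℂ) - ((c : ℂ) + t * Complex.I))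
        (Complex.continuousAt_Gamma_of_re_pos (by simpa using hd)) (by fun_prop)
    refine ((hG a ha).mul (hG b hb)).div (by fun_prop) fun t h => ?_
    have := congrArg Complex.re h
    simp at this
    exact hc.ne' this
  refine Integrable.mono' (integrable_inv_one_add_sq.const_mul
    (Real.Gamma (a - c + 1) * Real.Gamma (b - c) * (min (min c (a - c)) 1 ^ 2)⁻¹))
    hcont.aestronglyMeasurable (Filter.Eventually.of_forall fun t => ?_)
  have h1 := Complex.norm_Gamma_le_div_norm (s := (a : ℂ) - (c + t * Complex.I))
    (by simpa using ha)
  have h2 := Complex.norm_Gamma_le_Gamma_re (s := (b : ℂ) - (c + t * Complex.I))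
    (by simpa using hb)
  have h3 := inv_norm_mul_inv_norm_le hc (sub_pos.2 ha) t
  have e1 : (((a - c : ℝ) : ℂ) - t * Complex.I) = (a : ℂ) - (c + t * Complex.I) := by
    push_cast; ring
  rw [e1] at h3
  simp only [Complex.sub_re, Complex.add_re, Complex.ofReal_re, Complex.mul_re, Complex.I_re,
    Complex.I_im, Complex.ofReal_im, mul_zero, mul_one, sub_self, add_zero] at h1 h2
  have g1 : 0 < Real.Gamma (a - c + 1) := Real.Gamma_pos_of_pos (by linarith)
  have g2 : 0 < Real.Gamma (b - c) := Real.Gamma_pos_of_pos (by linarith)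
  rw [norm_div, norm_mul]
  calc _ ≤ Real.Gamma (a - c + 1) / ‖(a : ℂ) - (c + t * Complex.I)‖ * Real.Gamma (b - c) /
        ‖(c : ℂ) + t * Complex.I‖ := by gcongr
    _ = Real.Gamma (a - c + 1) * Real.Gamma (b - c) *
        (‖(a : ℂ) - (c + t * Complex.I)‖⁻¹ * ‖(c : ℂ) + t * Complex.I‖⁻¹) := by
      rw [div_eq_mul_inv, div_eq_mul_inv]; ring
    _ ≤ _ := by rw [mul_assoc _ _ (1 + t ^ 2)⁻¹]; gcongr

/-- The upper parameter `1` contributes `Γ(s)` and the lower parameter `0` contributes `1 / Γ(1 +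
s)`; their product is `1 / s`. -/
lemma meijerGIntegrand_two_one_eq (a b : ℝ) (z : ℂ) {s : ℂ} (hs : 0 < s.re) :
    meijerGIntegrand 2 1 ![1] ![(a : ℂ), (b : ℂ), 0] z s =
      Complex.Gamma (a - s) * Complex.Gamma (b - s) / s * z ^ s := by
  have h0 : s ≠ 0 := by rintro rfl; simp at hs
  have hG := Complex.Gamma_ne_zero_of_re_pos hs
  have h1 : Complex.Gamma (1 + s) = s * Complex.Gamma s := by
    rw [add_comm, Complex.Gamma_add_one s h0]
  simp [meijerGIntegrand, Fin.prod_univ_succ, h1]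
  field_simp
  exact Or.inl trivial

lemma meijerGSeparating_two_one_iff (a b c : ℝ) :
    MeijerGSeparating 2 1 ![1] ![(a : ℂ), (b : ℂ), 0] c ↔ 0 < c ∧ c < a ∧ c < b := by
  simp [MeijerGSeparating, Fin.forall_fin_succ]
  tauto

lemma verticalIntegrable_meijerGIntegrand_two_one {a b c u : ℝ} (hc : 0 < c) (ha : c < a)
    (hb : c < b) (hu : 0 < u) :
    Complex.VerticalIntegrable
      (meijerGIntegrand 2 1 ![1] ![(a : ℂ), (b : ℂ), 0] (u : ℂ)) c := by
  have h := verticalIntegrable_Gamma_mul_Gamma_div hc ha hb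
  have hcont : Continuous fun t : ℝ => (u : ℂ) ^ ((c : ℂ) + t * Complex.I) :=
    Continuous.const_cpow (by fun_prop) (Or.inl (by exact_mod_cast hu.ne'))
  refine (Integrable.mul_bdd (c := u ^ c) h hcont.aestronglyMeasurable
    (Filter.Eventually.of_forall fun t => ?_)).congr (Filter.Eventually.of_forall fun t => ?_)
  · rw [Complex.norm_cpow_eq_rpow_re_of_pos hu]; simp
  · simp only
    rw [meijerGIntegrand_two_one_eq _ _ _ (by simpa using hc)]

/-! ### Mellin transform and inversion for distribution functions -/

/-- A measure without an atom at `x` has a distribution function that is continuous at `x`. -/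
lemma continuousAt_measureReal_Iic (μ : Measure ℝ) [IsProbabilityMeasure μ] {x : ℝ}
    (hx : μ {x} = 0) : ContinuousAt (fun y => μ.real (Set.Iic y)) x := by
  simp_rw [← cdf_eq_real]
  -- The mass of `{x}` is the jump of the distribution function at `x`; right continuity always
  -- holds.
  have h := (cdf μ).measure_singleton x
  rw [measure_cdf, hx, eq_comm, ENNReal.ofReal_eq_zero, sub_nonpos] at h
  rw [continuousAt_iff_continuous_left'_right']
  exact ⟨(Monotone.continuousWithinAt_Iio_iff_leftLim_eq (cdf μ).mono).2
    (le_antisymm ((cdf μ).mono.leftLim_le le_rfl) h),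
    ((cdf μ).right_continuous x).mono Set.Ioi_subset_Ici_self⟩

/-- The Mellin transform, left of the imaginary axis, of the distribution function of a positive
random variable. -/
lemma hasMellin_measureReal_Iic (μ : Measure ℝ) [IsProbabilityMeasure μ]
    (hpos : ∀ᵐ v ∂μ, 0 < v) {s : ℂ} (hs : s.re < 0) (hint : Integrable (fun v => v ^ s.re) μ) :
    HasMellin (fun u => ((μ.real (Set.Iic u) : ℝ) : ℂ)) s (-(∫ v : ℝ, (v : ℂ) ^ s ∂μ) / s) := by
  set ν := (volume : Measure ℝ).restrict (Set.Ioi 0)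
  -- Integrating out `v` gives the Mellin integrand of the distribution function; integrating out
  -- `u` gives `-v ^ s / s`.
  set F : ℝ × ℝ → ℂ := fun p => {q : ℝ × ℝ | q.1 ≤ q.2}.indicator
    (fun q => (q.2 : ℂ) ^ (s - 1)) p with hF
  have hmeas : Measurable F :=
    Measurable.indicator (by fun_prop) (measurableSet_le measurable_fst measurable_snd)
  have hsec : ∀ v, 0 < v → ∀ g : ℝ → ℂ, ∫ u, (Set.Ici v).indicator g u ∂ν =
      ∫ u in Set.Ioi v, g u := by
    intro v hv g
    rw [integral_indicator measurableSet_Ici, Measure.restrict_restrict measurableSet_Ici,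
      Set.inter_eq_left.2 (Set.Ici_subset_Ioi.2 hv), integral_Ici_eq_integral_Ioi]
  have hsecR : ∀ v, 0 < v → ∀ g : ℝ → ℝ, ∫ u, (Set.Ici v).indicator g u ∂ν =
      ∫ u in Set.Ioi v, g u := by
    intro v hv g
    rw [integral_indicator measurableSet_Ici, Measure.restrict_restrict measurableSet_Ici,
      Set.inter_eq_left.2 (Set.Ici_subset_Ioi.2 hv), integral_Ici_eq_integral_Ioi]
  have hFv : ∀ v u, F (v, u) = (Set.Ici v).indicator (fun u : ℝ => (u : ℂ) ^ (s - 1)) u := by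
    intro v u; simp [hF, Set.indicator_apply]
  have hre : (s - 1).re < -1 := by simp; linarith
  have hFint : Integrable F (μ.prod ν) := by
    rw [integrable_prod_iff hmeas.aestronglyMeasurable]
    constructor
    · filter_upwards [hpos] with v hv
      simp_rw [hFv]
      rw [integrable_indicator_iff measurableSet_Ici, IntegrableOn,
        Measure.restrict_restrict measurableSet_Ici,
        Set.inter_eq_left.2 (Set.Ici_subset_Ioi.2 hv)]
      exact (integrableOn_Ici_iff_integrableOn_Ioi (by simp)).2 (integrableOn_Ioi_cpow_of_lt hre hv)
    · refine (hint.div_const (-s.re)).congr ?_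
      filter_upwards [hpos] with v hv
      simp_rw [hFv, norm_indicator_eq_indicator_norm]
      rw [hsecR v hv, setIntegral_congr_fun measurableSet_Ioi (g := fun u => u ^ (s.re - 1))
        (fun u hu => ?_), integral_Ioi_rpow_of_lt (by linarith) hv]
      · simp [neg_div, div_neg]
      · simp only
        rw [Complex.norm_cpow_eq_rpow_re_of_pos (hv.trans hu)]; simp
  have hinner : ∀ u : ℝ, ∫ v, F (v, u) ∂μ =
      (u : ℂ) ^ (s - 1) • ((μ.real (Set.Iic u) : ℝ) : ℂ) := by
    intro u
    have : (fun v => F (v, u)) = (Set.Iic u).indicator fun _ => (u : ℂ) ^ (s - 1) := by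
      ext v; simp [hF, Set.indicator_apply]
    rw [this, integral_indicator_const _ measurableSet_Iic, Complex.real_smul, smul_eq_mul,
      mul_comm]
  refine ⟨?_, ?_⟩
  · have := hFint.integral_prod_right
    simp_rw [hinner] at this
    exact this
  · have h := integral_integral_swap (f := fun v u => F (v, u)) hFint
    simp_rw [hinner] at h
    rw [mellin, ← h, ← integral_neg, ← integral_div]
    refine integral_congr_ae ?_
    filter_upwards [hpos] with v hv
    simp_rw [hFv]
    rw [hsec v hv, integral_Ioi_cpow_of_lt hre hv]
    simp

/-- Mellin inversion for the distribution function of a positive random variable with the moments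
`Γ(a + s) Γ(b + s) / (Γ(a) Γ(b))`. -/
lemma measureReal_Iic_eq_meijerGLine (μ : Measure ℝ) [IsProbabilityMeasure μ]
    (hpos : ∀ᵐ v ∂μ, 0 < v) {a b c u : ℝ} (hc : 0 < c) (ha : c < a) (hb : c < b) (hu : 0 < u)
    (hatom : μ {u} = 0)
    (hint : Integrable (fun v => v ^ (-c)) μ)
    (hmom : ∀ s : ℂ, s.re = -c → ∫ v : ℝ, (v : ℂ) ^ s ∂μ =
      Complex.Gamma (a + s) * Complex.Gamma (b + s) / (Real.Gamma a * Real.Gamma b)) :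
    ((μ.real (Set.Iic u) : ℝ) : ℂ) = 1 / ((Real.Gamma a : ℂ) * (Real.Gamma b : ℂ)) *
      meijerGLine 2 1 ![1] ![(a : ℂ), (b : ℂ), 0] (u : ℂ) c := by
  set f : ℝ → ℂ := fun u => ((μ.real (Set.Iic u) : ℝ) : ℂ) with hf
  set C : ℂ := 1 / ((Real.Gamma a : ℂ) * (Real.Gamma b : ℂ)) with hC
  set H : ℂ → ℂ := fun s => Complex.Gamma (a - s) * Complex.Gamma (b - s) / s with hH
  have hm : ∀ s : ℂ, s.re = -c → HasMellin f s (C * H (-s)) := by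
    intro s hs
    have := hasMellin_measureReal_Iic μ hpos (s := s) (by linarith) (by rwa [hs])
    convert this using 1
    rw [hmom s hs, hC, hH]
    simp only [sub_neg_eq_add]
    rw [div_neg, neg_div]
    ring
  have hline : ∀ y : ℝ, mellin f (((-c : ℝ) : ℂ) + y * Complex.I) =
      C * H ((c : ℂ) + ((-y : ℝ) : ℂ) * Complex.I) := by
    intro y
    rw [(hm _ (by simp)).2]
    congr 2
    push_cast; ring
  have hV : Complex.VerticalIntegrable (mellin f) (-c) := by
    unfold Complex.VerticalIntegrable
    simp_rw [hline]
    exact ((verticalIntegrable_Gamma_mul_Gamma_div hc ha hb).comp_neg).const_mul C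
  have hcont : ContinuousAt f u :=
    Complex.continuous_ofReal.continuousAt.comp (continuousAt_measureReal_Iic μ hatom)
  have key := mellinInv_mellin_eq (-c) f hu (hm _ (by simp)).1 hV hcont
  change f u = _
  rw [← key, mellinInv, meijerGLine]
  simp_rw [hline]
  have e : ∀ y : ℝ, (u : ℂ) ^ (-(((-c : ℝ) : ℂ) + y * Complex.I)) •
      (C * H ((c : ℂ) + ((-y : ℝ) : ℂ) * Complex.I)) =
      C * meijerGIntegrand 2 1 ![1] ![(a : ℂ), (b : ℂ), 0] (u : ℂ)
        ((c : ℂ) + ((-y : ℝ) : ℂ) * Complex.I) := by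
    intro y
    rw [meijerGIntegrand_two_one_eq _ _ _ (by simpa using hc)]
    have : -(((-c : ℝ) : ℂ) + y * Complex.I) = (c : ℂ) + ((-y : ℝ) : ℂ) * Complex.I := by
      push_cast; ring
    rw [this, smul_eq_mul, hH]
    ring
  simp_rw [e]
  -- Inversion runs along `Re s = -c`; reflecting `y` restores the upward orientation on `Re s = c`.
  rw [integral_neg_eq_self (fun y : ℝ => C * meijerGIntegrand 2 1 ![1] ![(a : ℂ), (b : ℂ), 0]
    (u : ℂ) ((c : ℂ) + (y : ℂ) * Complex.I)) volume, integral_const_mul, Complex.real_smul]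
  push_cast
  ring

/-! ### Complex moments of the Nakagami distribution -/

lemma measurable_nakagamiPDFReal (m Ω : ℝ) : Measurable (nakagamiPDFReal m Ω) :=
  Measurable.ite measurableSet_Ioi (by fun_prop) measurable_const

instance nakagamiMeasure.nullSingletonClass (m Ω : ℝ) :
    NullSingletonClass (nakagamiMeasure m Ω) :=
  inferInstanceAs (NullSingletonClass (volume.withDensity _))

instance nakagamiMeasure.sFinite (m Ω : ℝ) : SFinite (nakagamiMeasure m Ω) :=
  inferInstanceAs (SFinite (volume.withDensity _))

lemma ae_pos_nakagamiMeasure (m Ω : ℝ) : ∀ᵐ x ∂(nakagamiMeasure m Ω), 0 < x := by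
  rw [nakagamiMeasure, ae_withDensity_iff (measurable_nakagamiPDFReal m Ω).ennreal_ofReal]
  refine Filter.Eventually.of_forall fun x hx => ?_
  by_contra h
  simp [nakagamiPDFReal, h] at hx

lemma nakagamiPDFReal_nonneg {m Ω : ℝ} (hm : 0 < m) (hΩ : 0 < Ω) (x : ℝ) :
    0 ≤ nakagamiPDFReal m Ω x := by
  have := Real.Gamma_pos_of_pos hm
  unfold nakagamiPDFReal
  split_ifs <;> positivity

/-- The substitution `y = r * x ^ 2` reduces this to Euler's integral for `Γ(s)`. -/
lemma hasMellin_exp_neg_mul_sq {r : ℝ} (hr : 0 < r) {s : ℂ} (hs : 0 < s.re) :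
    HasMellin (fun x : ℝ => ((Real.exp (-(r * x ^ (2 : ℝ))) : ℝ) : ℂ)) (2 * s)
      ((r : ℂ) ^ (-s) * Complex.Gamma s / 2) := by
  have e : 2 * s / ((2 : ℝ) : ℂ) = s := by push_cast; field_simp
  refine ⟨?_, ?_⟩
  · refine (MellinConvergent.comp_rpow (f := fun y => ((Real.exp (-(r * y)) : ℝ) : ℂ))
      two_ne_zero).2 ?_
    rw [e]
    refine (MellinConvergent.comp_mul_left (f := fun y => ((Real.exp (-y) : ℝ) : ℂ)) hr).2 ?_
    refine (Complex.GammaIntegral_convergent hs).congr_fun (fun x _ => ?_) measurableSet_Ioi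
    simp [mul_comm]
  · rw [mellin_comp_rpow (fun y => ((Real.exp (-(r * y)) : ℝ) : ℂ)), e,
      mellin_comp_mul_left (fun y => ((Real.exp (-y) : ℝ) : ℂ)) _ hr,
      ← Complex.GammaIntegral_eq_mellin, ← Complex.Gamma_eq_integral hs]
    simp
    ring

lemma nakagamiPDFReal_smul_cpow {m Ω x : ℝ} (hm : 0 < m) (hΩ : 0 < Ω) (hx : 0 < x) (s : ℂ) :
    nakagamiPDFReal m Ω x • ((m / Ω * x ^ 2 : ℝ) : ℂ) ^ s =
      (2 * ((m / Ω : ℝ) : ℂ) ^ (m + s) / Complex.Gamma m) *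
        ((x : ℂ) ^ (2 * (m + s) - 1) •
          ((Real.exp (-(m / Ω * x ^ (2 : ℝ))) : ℝ) : ℂ)) := by
  have hr : 0 < m / Ω := by positivity
  have hr0 : ((m / Ω : ℝ) : ℂ) ≠ 0 := by exact_mod_cast hr.ne'
  have hx0 : (x : ℂ) ≠ 0 := by exact_mod_cast hx.ne'
  have h1 : m ^ m / (Real.Gamma m * Ω ^ m) = (m / Ω) ^ m / Real.Gamma m := by
    rw [Real.div_rpow hm.le hΩ.le]; field_simp
  have h2 : ((m / Ω * x ^ 2 : ℝ) : ℂ) ^ s = ((m / Ω : ℝ) : ℂ) ^ s * (x : ℂ) ^ (2 * s) := by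
    rw [Complex.ofReal_mul, Complex.mul_cpow_ofReal_nonneg hr.le (by positivity)]
    congr 1
    rw [two_mul, Complex.cpow_add _ _ hx0, ← Complex.mul_cpow_ofReal_nonneg hx.le hx.le, sq,
      Complex.ofReal_mul]
  have h3 : 2 * ((m : ℂ) + s) - 1 = ((2 * m - 1 : ℝ) : ℂ) + 2 * s := by push_cast; ring
  rw [nakagamiPDFReal, if_pos hx, h2, h3, Complex.cpow_add _ _ hr0, Complex.cpow_add _ _ hx0,
    Complex.Gamma_ofReal, ← Complex.ofReal_cpow hr.le, ← Complex.ofReal_cpow hx.le,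
    mul_div_assoc 2 (m ^ m), h1, Complex.real_smul, smul_eq_mul, Real.rpow_two, neg_mul]
  push_cast
  ring

/-- The complex moments of `(m / Ω) Z ^ 2`, for a Nakagami random variable `Z`. -/
lemma integrable_and_integral_cpow_nakagamiMeasure {m Ω : ℝ} (hm : 0 < m) (hΩ : 0 < Ω) {s : ℂ}
    (hs : 0 < m + s.re) :
    Integrable (fun x : ℝ => ((m / Ω * x ^ 2 : ℝ) : ℂ) ^ s) (nakagamiMeasure m Ω) ∧
      ∫ x : ℝ, ((m / Ω * x ^ 2 : ℝ) : ℂ) ^ s ∂(nakagamiMeasure m Ω) =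
        Complex.Gamma (m + s) / Complex.Gamma m := by
  have hr : 0 < m / Ω := by positivity
  have hr0 : ((m / Ω : ℝ) : ℂ) ≠ 0 := by exact_mod_cast hr.ne'
  have hmel := hasMellin_exp_neg_mul_sq hr (s := m + s) (by simpa using hs)
  have hmeas := (measurable_nakagamiPDFReal m Ω).ennreal_ofReal
  have hfin : ∀ᵐ x : ℝ, ENNReal.ofReal (nakagamiPDFReal m Ω x) < ⊤ := by simp
  have hsupp : ∀ x ∉ Set.Ioi (0 : ℝ),
      nakagamiPDFReal m Ω x • ((m / Ω * x ^ 2 : ℝ) : ℂ) ^ s = 0 := by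
    intro x hx
    have : ¬ 0 < x := hx
    simp [nakagamiPDFReal, this]
  have heq := fun x (hx : x ∈ Set.Ioi (0 : ℝ)) => nakagamiPDFReal_smul_cpow hm hΩ hx s
  constructor
  · rw [nakagamiMeasure, integrable_withDensity_iff_integrable_smul' hmeas hfin]
    simp_rw [ENNReal.toReal_ofReal (nakagamiPDFReal_nonneg hm hΩ _)]
    rw [← integrableOn_iff_integrable_of_support_subset (s := Set.Ioi (0 : ℝ))]
    · exact IntegrableOn.congr_fun (hmel.1.const_mul _) (fun x hx => (heq x hx).symm)
        measurableSet_Ioi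
    · intro x hx
      by_contra h
      exact hx (hsupp x h)
  · rw [nakagamiMeasure, integral_withDensity_eq_integral_toReal_smul hmeas hfin]
    simp_rw [ENNReal.toReal_ofReal (nakagamiPDFReal_nonneg hm hΩ _)]
    rw [← setIntegral_eq_integral_of_forall_compl_eq_zero hsupp,
      setIntegral_congr_fun measurableSet_Ioi heq, integral_const_mul]
    have := hmel.2
    rw [mellin] at this
    rw [this, Complex.cpow_neg]
    have h0 : ((m / Ω : ℝ) : ℂ) ^ ((m : ℂ) + s) ≠ 0 := by
      simp [Complex.cpow_eq_zero_iff, hm.ne', hΩ.ne']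
    field_simp

/-- Each slice at fixed `x` is contained in the point `y / x`, and is empty for `x = 0` since `y ≠
0`. -/
lemma nakagamiMeasure_prod_setOf_mul_eq {m₁ Ω₁ m₂ Ω₂ y : ℝ} (hy : y ≠ 0) :
    ((nakagamiMeasure m₁ Ω₁).prod (nakagamiMeasure m₂ Ω₂)) {p : ℝ × ℝ | p.1 * p.2 = y} = 0 := by
  refine (Measure.measure_prod_null
    (measurableSet_eq_fun (by fun_prop) (by fun_prop))).2 (Filter.Eventually.of_forall fun x => ?_)
  refine measure_mono_null (t := {y / x}) (fun z hz => ?_) (measure_singleton _)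
  have hz' : x * z = y := hz
  have : x ≠ 0 := by rintro rfl; exact hy (by rw [← hz', zero_mul])
  rw [Set.mem_singleton_iff, eq_div_iff this, mul_comm, hz']

/-! ### The product of two independent Nakagami variables -/

section Product

variable {S : Type*} [MeasurableSpace S] {P : Measure S} {Z₁ Z₂ : S → ℝ} {m₁ Ω₁ m₂ Ω₂ : ℝ}

lemma ProbabilityTheory.HasLaw.ae_pos_of_nakagami
    (hZ₁ : HasLaw Z₁ (nakagamiMeasure m₁ Ω₁) P) : ∀ᵐ ω ∂P, 0 < Z₁ ω :=
  (hZ₁.ae_iff measurableSet_Ioi.mem).2 (ae_pos_nakagamiMeasure m₁ Ω₁)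

lemma ProbabilityTheory.HasLaw.integrable_and_integral_cpow_of_nakagami (hm : 0 < m₁) (hΩ : 0 < Ω₁)
    (hZ₁ : HasLaw Z₁ (nakagamiMeasure m₁ Ω₁) P) {s : ℂ} (hs : 0 < m₁ + s.re) :
    Integrable (fun ω => ((m₁ / Ω₁ * Z₁ ω ^ 2 : ℝ) : ℂ) ^ s) P ∧
      ∫ ω, ((m₁ / Ω₁ * Z₁ ω ^ 2 : ℝ) : ℂ) ^ s ∂P = Complex.Gamma (m₁ + s) / Complex.Gamma m₁ := by
  obtain ⟨h1, h2⟩ := integrable_and_integral_cpow_nakagamiMeasure hm hΩ hs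
  constructor
  · rw [← hZ₁.map_eq] at h1
    exact h1.comp_aemeasurable hZ₁.aemeasurable
  · rw [← h2]
    exact hZ₁.integral_comp h1.aestronglyMeasurable

variable [IsProbabilityMeasure P]

/-- The distribution function of the product of two independent Nakagami random variables. -/
lemma measureReal_mul_le_eq_meijerGLine (hm₁ : 0 < m₁) (hΩ₁ : 0 < Ω₁) (hm₂ : 0 < m₂) (hΩ₂ : 0 < Ω₂)
    (hZ₁ : HasLaw Z₁ (nakagamiMeasure m₁ Ω₁) P) (hZ₂ : HasLaw Z₂ (nakagamiMeasure m₂ Ω₂) P)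
    (hindep : IndepFun Z₁ Z₂ P) {x c : ℝ} (hx : 0 < x) (hc : 0 < c) (h₁ : c < m₁) (h₂ : c < m₂) :
    ((P.real {ω | Z₁ ω * Z₂ ω ≤ x} : ℝ) : ℂ) =
      1 / ((Real.Gamma m₁ : ℂ) * (Real.Gamma m₂ : ℂ)) *
        meijerGLine 2 1 ![1] ![(m₁ : ℂ), (m₂ : ℂ), 0]
          ((x ^ 2 * (m₁ * m₂ / (Ω₁ * Ω₂)) : ℝ) : ℂ) c := by
  set V : S → ℝ := fun ω => (m₁ / Ω₁ * Z₁ ω ^ 2) * (m₂ / Ω₂ * Z₂ ω ^ 2) with hV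
  have hVeq : ∀ ω, V ω = (Z₁ ω * Z₂ ω) ^ 2 * (m₁ * m₂ / (Ω₁ * Ω₂)) := by
    intro ω; simp only [hV]; field_simp
  have hK : 0 < m₁ * m₂ / (Ω₁ * Ω₂) := by positivity
  set u := x ^ 2 * (m₁ * m₂ / (Ω₁ * Ω₂)) with hu
  have hm1 := hZ₁.aemeasurable
  have hm2 := hZ₂.aemeasurable
  have hVm : AEMeasurable V P := by fun_prop
  have hp1 := hZ₁.ae_pos_of_nakagami
  have hp2 := hZ₂.ae_pos_of_nakagami
  have : IsProbabilityMeasure (P.map V) := Measure.isProbabilityMeasure_map hVm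
  have hle : P.real {ω | Z₁ ω * Z₂ ω ≤ x} = (P.map V).real (Set.Iic u) := by
    rw [map_measureReal_apply_of_aemeasurable hVm measurableSet_Iic]
    refine measureReal_congr ?_
    filter_upwards [hp1, hp2] with ω hω1 hω2
    refine propext ?_
    change Z₁ ω * Z₂ ω ≤ x ↔ V ω ≤ u
    rw [hVeq, hu, mul_le_mul_iff_left₀ hK, sq_le_sq₀ (by positivity) hx.le]
  have hatom : (P.map V) {u} = 0 := by
    rw [Measure.map_apply_of_aemeasurable hVm (measurableSet_singleton u)]
    have hprod := (indepFun_iff_map_prod_eq_prod_map_map hm1 hm2).1 hindep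
    rw [hZ₁.map_eq, hZ₂.map_eq] at hprod
    have h0 := nakagamiMeasure_prod_setOf_mul_eq (m₁ := m₁) (Ω₁ := Ω₁) (m₂ := m₂) (Ω₂ := Ω₂) hx.ne'
    rw [← hprod, Measure.map_apply_of_aemeasurable (hm1.prodMk hm2)
      (measurableSet_eq_fun (by fun_prop) (by fun_prop))] at h0
    rw [← h0]
    refine measure_congr ?_
    filter_upwards [hp1, hp2] with ω hω1 hω2
    refine propext ?_
    change V ω = u ↔ Z₁ ω * Z₂ ω = x
    rw [hVeq, hu, mul_left_inj' hK.ne', sq_eq_sq₀ (by positivity) hx.le]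
  have hpos : ∀ᵐ v ∂(P.map V), 0 < v := by
    refine (ae_map_iff hVm measurableSet_Ioi).2 ?_
    filter_upwards [hp1, hp2] with ω hω1 hω2
    simp only [hV]
    positivity
  have hind : ∀ s : ℂ, IndepFun (fun ω => ((m₁ / Ω₁ * Z₁ ω ^ 2 : ℝ) : ℂ) ^ s)
      (fun ω => ((m₂ / Ω₂ * Z₂ ω ^ 2 : ℝ) : ℂ) ^ s) P := fun s =>
    hindep.comp (φ := fun z : ℝ => ((m₁ / Ω₁ * z ^ 2 : ℝ) : ℂ) ^ s)
      (ψ := fun z : ℝ => ((m₂ / Ω₂ * z ^ 2 : ℝ) : ℂ) ^ s) (by fun_prop) (by fun_prop)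
  have hVs : ∀ (s : ℂ) ω, (V ω : ℂ) ^ s =
      ((m₁ / Ω₁ * Z₁ ω ^ 2 : ℝ) : ℂ) ^ s * ((m₂ / Ω₂ * Z₂ ω ^ 2 : ℝ) : ℂ) ^ s := by
    intro s ω
    rw [← Complex.mul_cpow_ofReal_nonneg (by positivity) (by positivity), ← Complex.ofReal_mul]
  have hg1 : ∀ s : ℂ, s.re = -c → 0 < m₁ + s.re := fun s hs => by linarith
  have hg2 : ∀ s : ℂ, s.re = -c → 0 < m₂ + s.re := fun s hs => by linarith
  rw [hle]
  refine measureReal_Iic_eq_meijerGLine (P.map V) hpos hc h₁ h₂ (by positivity) hatom ?_ ?_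
  · have hs : ((-c : ℝ) : ℂ).re = -c := Complex.ofReal_re _
    rw [integrable_map_measure (Measurable.aestronglyMeasurable (by fun_prop)) hVm]
    -- The real moment is the real part of the complex one at `s = -c`.
    have := ((hind ((-c : ℝ) : ℂ)).integrable_mul
      (hZ₁.integrable_and_integral_cpow_of_nakagami hm₁ hΩ₁ (hg1 _ hs)).1
      (hZ₂.integrable_and_integral_cpow_of_nakagami hm₂ hΩ₂ (hg2 _ hs)).1).re
    refine this.congr (Filter.Eventually.of_forall fun ω => ?_)
    have hV0 : 0 ≤ V ω := by simp only [hV]; positivity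
    simp only [Pi.mul_apply, Function.comp_apply]
    rw [← hVs, ← Complex.ofReal_cpow hV0]
    simp
  · intro s hs
    rw [integral_map hVm (Measurable.aestronglyMeasurable (by fun_prop))]
    simp_rw [hVs]
    rw [(hind s).integral_fun_mul_eq_mul_integral
      (hZ₁.integrable_and_integral_cpow_of_nakagami hm₁ hΩ₁ (hg1 _ hs)).1.aestronglyMeasurable
      (hZ₂.integrable_and_integral_cpow_of_nakagami hm₂ hΩ₂ (hg2 _ hs)).1.aestronglyMeasurable,
      (hZ₁.integrable_and_integral_cpow_of_nakagami hm₁ hΩ₁ (hg1 _ hs)).2,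
      (hZ₂.integrable_and_integral_cpow_of_nakagami hm₂ hΩ₂ (hg2 _ hs)).2,
      Complex.Gamma_ofReal, Complex.Gamma_ofReal, div_mul_div_comm]

lemma meijerGWellDefined_and_measureReal_mul_le_eq (hm₁ : 0 < m₁) (hΩ₁ : 0 < Ω₁) (hm₂ : 0 < m₂)
    (hΩ₂ : 0 < Ω₂)
    (hZ₁ : HasLaw Z₁ (nakagamiMeasure m₁ Ω₁) P) (hZ₂ : HasLaw Z₂ (nakagamiMeasure m₂ Ω₂) P)
    (hindep : IndepFun Z₁ Z₂ P) {x : ℝ} (hx : 0 < x) :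
    MeijerGWellDefined 2 1 ![1] ![(m₁ : ℂ), (m₂ : ℂ), 0]
      ((x ^ 2 * (m₁ * m₂ / (Ω₁ * Ω₂)) : ℝ) : ℂ) ∧
    ((P.real {ω | Z₁ ω * Z₂ ω ≤ x} : ℝ) : ℂ) =
      1 / ((Real.Gamma m₁ : ℂ) * (Real.Gamma m₂ : ℂ)) *
        meijerG 2 1 ![1] ![(m₁ : ℂ), (m₂ : ℂ), 0]
          ((x ^ 2 * (m₁ * m₂ / (Ω₁ * Ω₂)) : ℝ) : ℂ) := by
  have hex : ∃ c : ℝ, MeijerGSeparating 2 1 ![1] ![(m₁ : ℂ), (m₂ : ℂ), 0] c := by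
    refine ⟨min m₁ m₂ / 2, (meijerGSeparating_two_one_iff _ _ _).2 ⟨by positivity, ?_, ?_⟩⟩
    · linarith [min_le_left m₁ m₂, lt_min hm₁ hm₂]
    · linarith [min_le_right m₁ m₂, lt_min hm₁ hm₂]
  have hline : ∀ c : ℝ, MeijerGSeparating 2 1 ![1] ![(m₁ : ℂ), (m₂ : ℂ), 0] c →
      ((P.real {ω | Z₁ ω * Z₂ ω ≤ x} : ℝ) : ℂ) =
        1 / ((Real.Gamma m₁ : ℂ) * (Real.Gamma m₂ : ℂ)) *
          meijerGLine 2 1 ![1] ![(m₁ : ℂ), (m₂ : ℂ), 0]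
            ((x ^ 2 * (m₁ * m₂ / (Ω₁ * Ω₂)) : ℝ) : ℂ) c := by
    intro c hsep
    obtain ⟨hc, h1, h2⟩ := (meijerGSeparating_two_one_iff _ _ _).1 hsep
    exact measureReal_mul_le_eq_meijerGLine hm₁ hΩ₁ hm₂ hΩ₂ hZ₁ hZ₂ hindep hx hc h1 h2
  have hG : 1 / ((Real.Gamma m₁ : ℂ) * (Real.Gamma m₂ : ℂ)) ≠ 0 := by
    have := (Real.Gamma_pos_of_pos hm₁).ne'
    have := (Real.Gamma_pos_of_pos hm₂).ne'
    refine one_div_ne_zero (mul_ne_zero ?_ ?_) <;> exact_mod_cast ‹_›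
  refine ⟨⟨hex, fun c hsep => ⟨?_, ?_⟩⟩, ?_⟩
  · obtain ⟨hc, h1, h2⟩ := (meijerGSeparating_two_one_iff _ _ _).1 hsep
    exact verticalIntegrable_meijerGIntegrand_two_one hc h1 h2 (by positivity)
  -- The integrals along `c` and along the chosen line represent the same probability; cancel the
  -- nonzero prefactor.
  · rw [meijerG, dif_pos hex]
    exact mul_left_cancel₀ hG ((hline c hsep).symm.trans (hline _ hex.choose_spec))
  · rw [meijerG, dif_pos hex]
    exact hline _ hex.choose_spec

end Product

/-! ### Positivity of the first von Mises moment -/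

/-- The mean resultant length of a von Mises distribution with `κ > 0` is positive. -/
lemma trigMoment_one_pos {κ : ℝ} (hκ : 0 < κ) : 0 < trigMoment 1 κ := by
  set I₀ := ∫ θ in (-Real.pi)..Real.pi, Real.exp (κ * Real.cos θ) with hI₀
  have hlt : -Real.pi < Real.pi := by linarith [Real.pi_pos]
  have hI₀pos : 0 < I₀ :=
    intervalIntegral.intervalIntegral_pos_of_pos
      (Continuous.intervalIntegrable (by fun_prop) _ _) (fun x => Real.exp_pos _) hlt
  have hpos : 0 < ∫ θ in (-Real.pi)..Real.pi, Real.cos θ * Real.exp (κ * Real.cos θ) := by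
    -- Since `cos` has integral zero over the period, `1` may be subtracted from the exponential;
    -- both factors then have the same sign everywhere.
    have hsub : ∫ θ in (-Real.pi)..Real.pi, Real.cos θ * Real.exp (κ * Real.cos θ) =
        ∫ θ in (-Real.pi)..Real.pi, Real.cos θ * (Real.exp (κ * Real.cos θ) - 1) := by
      simp_rw [mul_sub, mul_one]
      rw [intervalIntegral.integral_sub (Continuous.intervalIntegrable (by fun_prop) _ _)
        (Continuous.intervalIntegrable (by fun_prop) _ _)]
      simp
    rw [hsub]
    refine intervalIntegral.integral_pos hlt (by fun_prop) (fun x _ => ?_)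
      ⟨0, ⟨by linarith, by linarith⟩, ?_⟩
    · rcases le_total 0 (Real.cos x) with h | h
      · exact mul_nonneg h (sub_nonneg.2 (Real.one_le_exp (by positivity)))
      · exact mul_nonneg_of_nonpos_of_nonpos h
          (sub_nonpos.2 (Real.exp_le_one_iff.2 (mul_nonpos_of_nonneg_of_nonpos hκ.le h)))
    · simpa using hκ
  have hmeas : Measurable fun φ : ℝ => ENNReal.ofReal (Real.exp (κ * Real.cos φ) / I₀) := by
    fun_prop
  have hcont : Continuous fun φ : ℝ => (Real.exp (κ * Real.cos φ) / I₀) •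
      Complex.exp (Complex.I * ((1 : ℕ) : ℂ) * (φ : ℂ)) := by fun_prop
  rw [trigMoment, vonMisesMeasure, integral_withDensity_eq_integral_toReal_smul hmeas (by simp)]
  simp_rw [ENNReal.toReal_ofReal (div_nonneg (Real.exp_pos _).le hI₀pos.le)]
  have hint : IntegrableOn (fun φ : ℝ => (Real.exp (κ * Real.cos φ) / I₀) •
      Complex.exp (Complex.I * ((1 : ℕ) : ℂ) * (φ : ℂ))) (Set.Ioc (-Real.pi) Real.pi) :=
    hcont.integrableOn_Ioc
  have hre := integral_re hint
  rw [← RCLike.re_to_complex, ← hre, ← intervalIntegral.integral_of_le hlt.le]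
  have e : ∀ φ : ℝ, RCLike.re ((Real.exp (κ * Real.cos φ) / I₀) •
      Complex.exp (Complex.I * ((1 : ℕ) : ℂ) * (φ : ℂ))) =
      Real.cos φ * Real.exp (κ * Real.cos φ) / I₀ := by
    intro φ
    have : Complex.I * ((1 : ℕ) : ℂ) * (φ : ℂ) = φ * Complex.I := by push_cast; ring
    rw [this]
    simp only [RCLike.re_to_complex, Complex.real_smul, Complex.re_ofReal_mul,
      Complex.exp_ofReal_mul_I_re]
    ring
  simp_rw [e]
  rw [intervalIntegral.integral_div]
  positivity

/-! ### Positivity of the network parameters and the outage event -/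

namespace CascadedRIS

lemma spreadBar_pos (R : CascadedRIS) {k : ℕ} (hk : k = 1 ∨ k = R.L) : 0 < R.spreadBar k := by
  have hm := R.m_pos k hk
  have h1 := trigMoment_one_pos (R.κ_pos k hk)
  have h2 := Real.Gamma_pos_of_pos hm
  have h3 : 0 < Real.Gamma (R.m k + 1 / 2) := Real.Gamma_pos_of_pos (by positivity)
  have h4 := R.Ω_pos k hk
  unfold spreadBar
  positivity

lemma shapeBar_pos (R : CascadedRIS) {k : ℕ} (hk : k = 1 ∨ k = R.L) (h : 0 < R.shapeDenom k) :
    0 < R.shapeBar k := by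
  have hN : 0 < R.N k := R.N_pos k <| by
    have := R.two_le_L
    rw [Finset.mem_Icc]
    omega
  have := R.spreadBar_pos hk
  unfold shapeBar
  positivity

lemma pathLoss_pos (R : CascadedRIS) : 0 < R.pathLoss :=
  Finset.prod_pos fun i hi =>
    mul_pos R.C₀_pos (Real.rpow_pos_of_pos (div_pos (R.d_pos i hi) R.d₀_pos) _)

lemma gain_pos (R : CascadedRIS) : 0 < R.gain := mul_pos R.Gt_pos R.Gr_pos

lemma prod_N_pos (R : CascadedRIS) : 0 < ∏ i ∈ Finset.Icc 1 R.L, (R.N i : ℝ) :=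
  Finset.prod_pos fun i hi => Nat.cast_pos.2 (R.N_pos i hi)

lemma w_pos (R : CascadedRIS) {γ : ℝ} (hγ : 0 < γ) : 0 < R.w γ := by
  have h1 := R.pathLoss_pos
  have h2 := R.gain_pos
  have h3 := R.prod_N_pos
  have h4 := R.Pt_pos
  have h5 := R.σ_pos
  refine Real.sqrt_pos.2 ?_
  rw [Finset.prod_pow]
  positivity

lemma snr_le_iff (R : CascadedRIS) {γ z₁ zL : ℝ} (hγ : 0 < γ) (hz : 0 ≤ z₁ * zL) :
    R.snr z₁ zL ≤ γ ↔ z₁ * zL ≤ R.w γ := by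
  have h1 := R.pathLoss_pos
  have h2 := R.gain_pos
  have h3 := R.prod_N_pos
  have h4 := R.Pt_pos
  have h5 := R.σ_pos
  rw [w, Real.le_sqrt hz (by rw [Finset.prod_pow]; positivity), Finset.prod_pow,
    le_div_iff₀ (by positivity), ← div_le_iff₀ (by positivity), snr]
  refine iff_of_eq (congrArg (· ≤ γ) ?_)
  ring

end CascadedRIS

theorem proposition2
    (R : CascadedRIS)
    (h₁ : 0 < R.shapeDenom 1) (hL : 0 < R.shapeDenom R.L)
    {S : Type*} [MeasurableSpace S] (P : Measure S) [IsProbabilityMeasure P]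
    (Z₁ ZL : S → ℝ)
    (hZ₁ : HasLaw Z₁ (nakagamiMeasure (R.shapeBar 1) (R.spreadBar 1)) P)
    (hZL : HasLaw ZL (nakagamiMeasure (R.shapeBar R.L) (R.spreadBar R.L)) P)
    (hindep : IndepFun Z₁ ZL P) :
    -- the cumulative distribution function of the product of the amplitudes
    (∀ x : ℝ, 0 < x →
      MeijerGWellDefined 2 1 ![1] ![(R.shapeBar 1 : ℂ), (R.shapeBar R.L : ℂ), 0] (R.gArg x : ℂ) ∧
      ((P.real {ω | Z₁ ω * ZL ω ≤ x} : ℝ) : ℂ) =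
        1 / ((Real.Gamma (R.shapeBar 1) : ℂ) * (Real.Gamma (R.shapeBar R.L) : ℂ)) *
          meijerG 2 1 ![1] ![(R.shapeBar 1 : ℂ), (R.shapeBar R.L : ℂ), 0] (R.gArg x : ℂ)) ∧
    -- the outage probability
    (∀ γthr : ℝ, 0 < γthr →
      P.real {ω | R.snr (Z₁ ω) (ZL ω) ≤ γthr} = P.real {ω | Z₁ ω * ZL ω ≤ R.w γthr} ∧
      ((P.real {ω | R.snr (Z₁ ω) (ZL ω) ≤ γthr} : ℝ) : ℂ) =
        1 / ((Real.Gamma (R.shapeBar 1) : ℂ) * (Real.Gamma (R.shapeBar R.L) : ℂ)) *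
          meijerG 2 1 ![1] ![(R.shapeBar 1 : ℂ), (R.shapeBar R.L : ℂ), 0]
            (R.gArg (R.w γthr) : ℂ)) := by

  have hm₁ := R.shapeBar_pos (Or.inl rfl) h₁
  have hmL := R.shapeBar_pos (Or.inr rfl) hL
  have hΩ₁ := R.spreadBar_pos (k := 1) (Or.inl rfl)
  have hΩL := R.spreadBar_pos (k := R.L) (Or.inr rfl)
  have hmain : ∀ x : ℝ, 0 < x → _ := fun x hx =>
    meijerGWellDefined_and_measureReal_mul_le_eq hm₁ hΩ₁ hmL hΩL hZ₁ hZL hindep hx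
  refine ⟨hmain, fun γ hγ => ?_⟩
  have heq : P.real {ω | R.snr (Z₁ ω) (ZL ω) ≤ γ} = P.real {ω | Z₁ ω * ZL ω ≤ R.w γ} := by
    refine measureReal_congr ?_
    filter_upwards [hZ₁.ae_pos_of_nakagami, hZL.ae_pos_of_nakagami] with ω hω₁ hωL
    exact propext (R.snr_le_iff hγ (mul_pos hω₁ hωL).le)
  exact ⟨heq, heq ▸ (hmain _ (R.w_pos hγ)).2⟩
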